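/- **Setting.** Fix a horizon $T$, a norm $\|\cdot\|$ equal to the $p$-norm with $p=2$ or $p=\infty$ (and the induced matrix norm), and let $\mathcal B(\rho)$ be the closed ball of radius $\rho$ around $0$. In iterations $k=0,1,2,\dots$ the system $$x_k(t+1)=f(x_k(t),t)+A(t)x_k(t)+B(t)u_k(t)+w_k(t),\qquad t=0,\dots,T-1,$$ is run. Let $\mathscr X=\{(x,u):H_xx+H_uu\le h\}$, $\mathscr X_T=\{x:H_{x,T}x\le h_T\}$, $\mathscr X_x=\{x:\exists u,\ (x,u)\in\mathscr X\}$; for $\delta=(\delta(0),\dots,\delta(T))$ let $\mathscr Z^\delta$ be the set of $(z,v)=(z(0),\dots,z(T),v(0),\dots,v(T-1))$ with $H_xz(t)+H_uv(t)\le h-\delta(t)$ for $t<T$ and $H_{x,T}z(T)\le h_T-\delta(T)$. Given gains $K(t)$, put $A_K=A+BK$ and, row-wise, $\psi(t)=\sup_{v\in\mathcal B(1)}[H_x+H_uK(t)]v$ for $t<T$, $\psi(T)=\sup_{v\in\mathcal B(1)}H_{x,T}v$; write $\psi\eta$ for $t\mapsto\psi(t)\eta(t)$. Let $m(t)>0$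 be known numbers, $\bar m(t)=\|A_K(t)\|+m(t)$, $\mathcal W=\mathcal B(\bar w)$, let $Q$ be symmetric positive definite, $P$ symmetric positive semidefinite, $r=(r(0),\dots,r(T))$ a reference, and $\|y\|_Q^2=\sum_t y(t)^\top Qy(t)$. **Estimates.** With $\bar d_j(t)=x_j(t+1)-A(t)x_j(t)-B(t)u_j(t)$, let $$\mathcal D_n(y,t)=\bigcap_{j=0}^n\big(\bar d_j(t)+\mathcal W+\mathcal B(m(t)\|x_j(t)-y\|)\big).$$ **Scheme with parameter $c_1>0$.** Put $x_0^{\rm ref}=x_0$. Before iteration $k\ge1$ choose a minimizer $(z_k,v_k,\xi_k,\rho_k,\eta_k,d_k^{\rm ref},x_k^{\rm ref},\alpha_k)$ of the ILC problem: minimize $$\|z-r\|_Q^2+c_1\sum_{t<T}|\xi(t)|+\sum_{t<T}\tfrac{c_1}{m(t)}\rho(t)$$ subject to $z(0)=\bar x$, $\eta(0)=r_0$, $(z,v)\in\mathscr Z^{\psi\eta}$ and, for $t<T$, $z(t+1)=A(t)z(t)+B(t)v(t)+d^{\rm ref}(t)$, $\eta(t+1)=\bar m(t)\eta(t)+m(t)\xi(t)+\rho(t)+\bar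 w$, $\alpha(t)\in\{0,1\}$, $x^{\rm ref}(t)=\alpha(t)x_{k-1}(t)+(1-\alpha(t))x_{k-1}^{\rm ref}(t)$, $\|z(t)-x^{\rm ref}(t)\|\le\xi(t)$, $\rho(t)\ge0$, and $\|d^{\rm ref}(t)-\alpha(t)d_1-(1-\alpha(t))d_2\|\le\rho(t)$ for all $d_1\in\mathcal D_{k-1}(x_{k-1}(t),t)$, $d_2\in\mathcal D_{k-1}(x_{k-1}^{\rm ref}(t),t)$. During iteration $k\ge 1$, at each time $i=0,\dots,T-1$, choose a minimizer $(z_k^i,v_k^i,\xi_k^i,\eta_k^i)$ of the MPC problem: minimize $$\sum_{t=0}^{T-i}\|z(t)-r(i+t)\|_Q^2+c_1\sum_{t<T-i}|\xi(t)|+\sum_{t<T-i}\|v(t)-v_k(i+t)\|_P^2$$ subject to $\eta(0)\ge\|z(0)-x_k(i)\|$, $H_{x,T}z(T-i)\le h_T-\psi(T)\eta(T-i)$ and, for $t<T-i$, $z(t+1)=A(i+t)z(t)+B(i+t)v(t)+d_k^{\rm ref}(i+t)$, $\eta(t+1)=\bar m(i+t)\eta(t)+m(i+t)\xi(t)+\rho_k(i+t)+\bar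 w$, $\|z(t)-x_k^{\rm ref}(i+t)\|\le\xi(t)$, $H_xz(t)+H_uv(t)\le h-\psi(i+t)\eta(t)$; then apply $u_k(i)=v_k^i(0)+K(i)(x_k(i)-z_k^i(0))$. **Theorem.** Assume that: 1. $\|f(x,t)-f(y,t)\|\le L(t)\|x-y\|$ for all $t<T$ and $x,y\in\mathscr X_x$, with $0\le L(t)\le m(t)$; 2. there are $v^*,\eta^*$ such that $(r,v^*,\eta^*)$ minimizes $\|z-r\|_Q^2$ over all $(z,v,\eta)$ with $z(0)=\bar x$, $z(t+1)=A(t)z(t)+B(t)v(t)+f(z(t),t)$, $\eta(0)=r_0$, $\eta(t+1)=\bar m(t)\eta(t)+\bar w$ for $t<T$, and $(z,v)\in\mathscr Z^{\psi\eta}$; 3. the noise $w_k(t)$ is random with $w_k(t)\in\mathcal W$ almost surely and $\Pr\{w_k(t)\in U\}>0$ for every $U\subseteq\mathcal W$ with nonempty interior, for all $k$ and $t$. Then there are functions $h_0,\dots,h_T\in\mathcal K_\infty$ (continuous and strictly increasing $[0,\infty)\to[0,\infty)$, zero at zero, unbounded), not depending on $c_1$, such that for every $c_1>0$ and every closed loop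 generated by the scheme with parameter $c_1$ for which, almost surely, 4. $x_k(0)\in\bar x+\mathcal B(r_0)$ for all $k\ge0$; 5. $(x_0,u_0)\in\mathscr Z^{\psi\eta_0}$, where $\eta_0(0)=\bar w$ and $\eta_0(t+1)=\bar m(t)\eta_0(t)+2\bar w$; 6. $(z_k,v_k)\in\operatorname{int}\mathscr Z^{\psi\eta_k}$ for all $k\ge1$ (with $\eta_k$ held fixed), one has, with probability $1$, $$\limsup_{k\to\infty}\|z_k(t)-r(t)\|\le h_t(c_1)\qquad\text{for all }t=0,\dots,T.$$ -/

import Mathlib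

open scoped Pointwise ENNReal

noncomputable section

/-- Column vectors of length `n`. -/
abbrev Vec (n : ℕ) : Type := Fin n → ℝ

/-- The `p`-norm of a vector. -/
def pnorm (p : ℝ≥0∞) {n : ℕ} (x : Vec n) : ℝ := ‖WithLp.toLp p x‖

/-- The closed `p`-norm ball of radius `ρ` around the origin. -/
def pball (p : ℝ≥0∞) {n : ℕ} (ρ : ℝ) : Set (Vec n) := {x | pnorm p x ≤ ρ}

/-- The matrix norm induced by the `p`-norm. -/
def inducedNorm (p : ℝ≥0∞) {n : ℕ} (M : Matrix (Fin n) (Fin n) ℝ) : ℝ :=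
  sSup ((fun x : Vec n => pnorm p (M.mulVec x)) '' pball p 1)

/-- The row-wise supremum of `M v` over the closed unit `p`-norm ball. -/
def rowSup (p : ℝ≥0∞) {n l : ℕ} (M : Matrix (Fin l) (Fin n) ℝ) : Vec l :=
  fun j => sSup ((fun v : Vec n => (M.mulVec v) j) '' pball p 1)

/-- The squared weighted norm `∑ t, (y t)ᵀ Q (y t)` of a trajectory. -/
def weightedSq {n l : ℕ} (Q : Matrix (Fin n) (Fin n) ℝ) (y : Fin l → Vec n) : ℝ :=
  ∑ t, y t ⬝ᵥ Q.mulVec (y t)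

/-- Class `𝒦∞` functions (only the values on `[0, ∞)` matter). -/
structure IsClassKInf (a : ℝ → ℝ) : Prop where
  continuousOn : ContinuousOn a (Set.Ici 0)
  strictMonoOn : StrictMonoOn a (Set.Ici 0)
  zero : a 0 = 0
  tendsto : Filter.Tendsto a Filter.atTop Filter.atTop

/-- The data of the control problem, apart from the cost parameter `c₁`. States live in `Vec nx`,
inputs in `Vec nu`, there are `nh` stage constraints, `nhT` terminal constraints, and the
horizon is `T`. -/
structure ILPC (nx nu nh nhT T : ℕ) where
  /-- exponent of the norm -/
  p : ℝ≥0∞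
  A : Fin T → Matrix (Fin nx) (Fin nx) ℝ
  B : Fin T → Matrix (Fin nx) (Fin nu) ℝ
  /-- feedback gains -/
  K : Fin T → Matrix (Fin nu) (Fin nx) ℝ
  /-- state-dependent disturbance (unknown to the controller) -/
  f : Vec nx → Fin T → Vec nx
  /-- Lipschitz constants of the disturbance (unknown to the controller) -/
  L : Fin T → ℝ
  /-- known upper bounds on the Lipschitz constants -/
  m : Fin T → ℝ
  Hx : Matrix (Fin nh) (Fin nx) ℝ
  Hu : Matrix (Fin nh) (Fin nu) ℝ
  h : Vec nh
  HxT : Matrix (Fin nhT) (Fin nx) ℝ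
  hT : Vec nhT
  /-- nominal initial state -/
  xbar : Vec nx
  /-- radius of the set of initial states -/
  r0 : ℝ
  /-- noise bound -/
  wbar : ℝ
  /-- reference -/
  r : Fin (T + 1) → Vec nx
  /-- tracking weight -/
  Q : Matrix (Fin nx) (Fin nx) ℝ
  /-- input weight of the predictive controller -/
  P : Matrix (Fin nu) (Fin nu) ℝ

/-- Decision variables of the iterative learning problem. -/
structure ILCVar (nx nu T : ℕ) where
  z : Fin (T + 1) → Vec nx
  v : Fin T → Vec nu
  ξ : Fin T → ℝ
  ρ : Fin T → ℝ
  η : Fin (T + 1) → ℝ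
  dref : Fin T → Vec nx
  xref : Fin T → Vec nx
  α : Fin T → ℝ

/-- Decision variables of the predictive control problem with `N` remaining time-steps. -/
structure MPCVar (nx nu N : ℕ) where
  z : Fin (N + 1) → Vec nx
  v : Fin N → Vec nu
  ξ : Fin N → ℝ
  η : Fin (N + 1) → ℝ

namespace ILPC

variable {nx nu nh nhT T : ℕ} (S : ILPC nx nu nh nhT T)

/-- Closed-loop matrix `A(t) + B(t) K(t)`. -/
def AK (t : Fin T) : Matrix (Fin nx) (Fin nx) ℝ := S.A t + S.B t * S.K t

/-- `‖A_K(t)‖ + m(t)`. -/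
def mbar (t : Fin T) : ℝ := inducedNorm S.p (S.AK t) + S.m t

/-- Stage constraint set tightened by `δ`. -/
def stageSet (δ : Vec nh) : Set (Vec nx × Vec nu) :=
  {q | S.Hx.mulVec q.1 + S.Hu.mulVec q.2 ≤ S.h - δ}

/-- Terminal constraint set tightened by `δ`. -/
def terminalSet (δ : Vec nhT) : Set (Vec nx) := {x | S.HxT.mulVec x ≤ S.hT - δ}

/-- States admitting an input that satisfies the (untightened) stage constraints. -/
def stateSet : Set (Vec nx) := {x | ∃ u : Vec nu, (x, u) ∈ S.stageSet 0}

/-- Trajectories satisfying the constraints tightened by `δ` (stages) and `δT` (terminal). -/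
def trajSet (δ : Fin T → Vec nh) (δT : Vec nhT) :
    Set ((Fin (T + 1) → Vec nx) × (Fin T → Vec nu)) :=
  {q | (∀ t : Fin T, (q.1 t.castSucc, q.2 t) ∈ S.stageSet (δ t)) ∧
    q.1 (Fin.last T) ∈ S.terminalSet δT}

/-- Support vector of the stage constraints. -/
def psi (t : Fin T) : Vec nh := rowSup S.p (S.Hx + S.Hu * S.K t)

/-- Support vector of the terminal constraints. -/
def psiT : Vec nhT := rowSup S.p S.HxT

/-- The constraint set tightened by `δ(t) = ψ(t) η(t)`. -/
def tightSet (η : Fin (T + 1) → ℝ) : Set ((Fin (T + 1) → Vec nx) × (Fin T → Vec nu)) :=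
  S.trajSet (fun t => η t.castSucc • S.psi t) (η (Fin.last T) • S.psiT)

/-! ### Assumptions on the problem data -/

/-- The disturbance is Lipschitz on the set of admissible states, with a known bound on the
Lipschitz constant. -/
def LipschitzDisturbance : Prop :=
  ∀ t : Fin T, 0 ≤ S.L t ∧ S.L t ≤ S.m t ∧
    ∀ x ∈ S.stateSet, ∀ y ∈ S.stateSet,
      pnorm S.p (S.f x t - S.f y t) ≤ S.L t * pnorm S.p (x - y)

/-- Feasibility for the robust tracking problem with known disturbance function: nominal dynamics
driven by the true `f`, and the tube radii `η` of the corresponding error dynamics. -/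
structure RobustFeasible (z : Fin (T + 1) → Vec nx) (v : Fin T → Vec nu)
    (η : Fin (T + 1) → ℝ) : Prop where
  z_init : z 0 = S.xbar
  z_dyn : ∀ t : Fin T, z t.succ =
    (S.A t).mulVec (z t.castSucc) + (S.B t).mulVec (v t) + S.f (z t.castSucc) t
  η_init : η 0 = S.r0
  η_dyn : ∀ t : Fin T, η t.succ = S.mbar t * η t.castSucc + S.wbar
  mem : (z, v) ∈ S.tightSet η

/-- `(z, v, η)` solves the robust tracking problem with known disturbance function. -/
def RobustSolution (z : Fin (T + 1) → Vec nx) (v : Fin T → Vec nu)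
    (η : Fin (T + 1) → ℝ) : Prop :=
  S.RobustFeasible z v η ∧ ∀ z' v' η', S.RobustFeasible z' v' η' →
    weightedSq S.Q (z - S.r) ≤ weightedSq S.Q (z' - S.r)

/-- The reference is realizable. -/
def RealizableReference : Prop := ∃ vstar ηstar, S.RobustSolution S.r vstar ηstar

/-- The noise is bounded, and gives positive probability to every set with interior points. -/
def NoiseAssumption {Ω : Type*} [MeasurableSpace Ω] (μ : MeasureTheory.Measure Ω)
    (w : ℕ → Fin T → Ω → Vec nx) : Prop :=
  (∀ᵐ ω ∂μ, ∀ k t, w k t ω ∈ pball S.p S.wbar) ∧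
  ∀ k t, ∀ U : Set (Vec nx), U ⊆ pball S.p S.wbar → (interior U).Nonempty →
    0 < μ {ω | w k t ω ∈ U}

/-! ### Set-membership estimates -/

/-- Disturbance measurement `x(t+1) - A(t) x(t) - B(t) u(t)` of one iteration. -/
def dbar (x : Fin (T + 1) → Vec nx) (u : Fin T → Vec nu) (t : Fin T) : Vec nx :=
  x t.succ - (S.A t).mulVec (x t.castSucc) - (S.B t).mulVec (u t)

/-- Set estimate of the disturbance value `f(y, t)` from the measurements of the
iterations `0, …, n`. -/
def estSet (x : ℕ → Fin (T + 1) → Vec nx) (u : ℕ → Fin T → Vec nu) (n : ℕ) (t : Fin T)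
    (y : Vec nx) : Set (Vec nx) :=
  ⋂ j ∈ Set.Iic n, (({S.dbar (x j) (u j) t} : Set (Vec nx)) + pball S.p S.wbar +
    pball S.p (S.m t * pnorm S.p (x j t.castSucc - y)))

/-! ### The iterative learning problem -/

/-- Constraints of the iterative learning problem, given the set estimates `D`, `Dref` and
the previous trajectory `xprev` and state reference `xrefprev`. -/
structure ILCFeasible (D Dref : Fin T → Set (Vec nx)) (xprev xrefprev : Fin T → Vec nx)
    (X : ILCVar nx nu T) : Prop where
  z_init : X.z 0 = S.xbar
  η_init : X.η 0 = S.r0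
  z_dyn : ∀ t : Fin T, X.z t.succ =
    (S.A t).mulVec (X.z t.castSucc) + (S.B t).mulVec (X.v t) + X.dref t
  η_dyn : ∀ t : Fin T, X.η t.succ =
    S.mbar t * X.η t.castSucc + S.m t * X.ξ t + X.ρ t + S.wbar
  α_mem : ∀ t, X.α t = 0 ∨ X.α t = 1
  xref_eq : ∀ t, X.xref t = X.α t • xprev t + (1 - X.α t) • xrefprev t
  ξ_bound : ∀ t : Fin T, pnorm S.p (X.z t.castSucc - X.xref t) ≤ X.ξ t
  ρ_nonneg : ∀ t, 0 ≤ X.ρ t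
  ρ_bound : ∀ t, ∀ d₁ ∈ D t, ∀ d₂ ∈ Dref t,
    pnorm S.p (X.dref t - X.α t • d₁ - (1 - X.α t) • d₂) ≤ X.ρ t
  mem : (X.z, X.v) ∈ S.tightSet X.η

/-- Cost of the iterative learning problem, with `c₂(t) = c₁ / m(t)`. -/
def ilcCost (c₁ : ℝ) (X : ILCVar nx nu T) : ℝ :=
  weightedSq S.Q (X.z - S.r) + c₁ * ∑ t, |X.ξ t| + ∑ t, c₁ / S.m t * X.ρ t

/-- `X` is an optimizer of the iterative learning problem. -/
def ILCSolution (c₁ : ℝ) (D Dref : Fin T → Set (Vec nx)) (xprev xrefprev : Fin T → Vec nx)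
    (X : ILCVar nx nu T) : Prop :=
  S.ILCFeasible D Dref xprev xrefprev X ∧
    ∀ X', S.ILCFeasible D Dref xprev xrefprev X' → S.ilcCost c₁ X ≤ S.ilcCost c₁ X'

/-! ### The predictive control problem -/

/-- The absolute time `i + t` of stage `t` of the problem posed at time `i`. -/
def absTime (i : Fin T) (t : Fin (T - i)) : Fin T :=
  ⟨i.1 + t.1, by have := t.2; omega⟩

/-- The reference seen from time `i`. -/
def refFrom (i : Fin T) (t : Fin (T - i + 1)) : Vec nx :=
  S.r ⟨i.1 + t.1, by have := t.2; have := i.2; omega⟩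

/-- Constraints of the predictive control problem at time `i`, given the measured state `x` and
the optimizer `X` of the iterative learning problem of the current iteration. -/
structure MPCFeasible (i : Fin T) (x : Vec nx) (X : ILCVar nx nu T)
    (Y : MPCVar nx nu (T - i)) : Prop where
  η_init : pnorm S.p (Y.z 0 - x) ≤ Y.η 0
  z_dyn : ∀ t : Fin (T - i), Y.z t.succ =
    (S.A (absTime i t)).mulVec (Y.z t.castSucc) + (S.B (absTime i t)).mulVec (Y.v t) +
      X.dref (absTime i t)
  η_dyn : ∀ t : Fin (T - i), Y.η t.succ =
    S.mbar (absTime i t) * Y.η t.castSucc + S.m (absTime i t) * Y.ξ t +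
      X.ρ (absTime i t) + S.wbar
  ξ_bound : ∀ t : Fin (T - i), pnorm S.p (Y.z t.castSucc - X.xref (absTime i t)) ≤ Y.ξ t
  stage : ∀ t : Fin (T - i),
    (Y.z t.castSucc, Y.v t) ∈ S.stageSet (Y.η t.castSucc • S.psi (absTime i t))
  terminal : Y.z (Fin.last _) ∈ S.terminalSet (Y.η (Fin.last _) • S.psiT)

/-- Cost of the predictive control problem. -/
def mpcCost (c₁ : ℝ) (i : Fin T) (X : ILCVar nx nu T) (Y : MPCVar nx nu (T - i)) : ℝ :=
  weightedSq S.Q (Y.z - S.refFrom i) + c₁ * ∑ t, |Y.ξ t| +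
    weightedSq S.P (fun t => Y.v t - X.v (absTime i t))

/-- `Y` is an optimizer of the predictive control problem. -/
def MPCSolution (c₁ : ℝ) (i : Fin T) (x : Vec nx) (X : ILCVar nx nu T)
    (Y : MPCVar nx nu (T - i)) : Prop :=
  S.MPCFeasible i x X Y ∧
    ∀ Y', S.MPCFeasible i x X Y' → S.mpcCost c₁ i X Y ≤ S.mpcCost c₁ i X Y'

/-! ### The closed loop -/

/-- The state references: the measured trajectory of iteration `0`, afterwards the one selected
by the iterative learning problem. -/
def stateRef (x : ℕ → Fin (T + 1) → Vec nx) (X : ℕ → ILCVar nx nu T) : ℕ → Fin T → Vec nx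
  | 0 => fun t => x 0 t.castSucc
  | k + 1 => (X (k + 1)).xref

/-- A sample path of the closed loop: `x k`, `u k`, `w k` are the states, inputs and noise of
iteration `k`, `X k` (`k ≥ 1`) is the optimizer of the iterative learning problem solved
before iteration `k`, and `Y k i` (`k ≥ 1`) is the optimizer of the predictive control
problem solved at time `i` of iteration `k`. The entry `X 0` and the entries `Y 0 i` are
not used. -/
structure IsRun (c₁ : ℝ) (w : ℕ → Fin T → Vec nx) (x : ℕ → Fin (T + 1) → Vec nx)
    (u : ℕ → Fin T → Vec nu) (X : ℕ → ILCVar nx nu T)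
    (Y : ℕ → (i : Fin T) → MPCVar nx nu (T - i)) : Prop where
  plant : ∀ k (t : Fin T), x k t.succ = S.f (x k t.castSucc) t +
    (S.A t).mulVec (x k t.castSucc) + (S.B t).mulVec (u k t) + w k t
  ilc : ∀ k, S.ILCSolution c₁
    (fun t => S.estSet x u k t (x k t.castSucc))
    (fun t => S.estSet x u k t (stateRef x X k t))
    (fun t => x k t.castSucc) (stateRef x X k) (X (k + 1))
  mpc : ∀ k, 1 ≤ k → ∀ i : Fin T, S.MPCSolution c₁ i (x k i.castSucc) (X k) (Y k i)
  input : ∀ k, 1 ≤ k → ∀ i : Fin T, u k i =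
    (Y k i).v ⟨0, by have := i.2; omega⟩ + (S.K i).mulVec (x k i.castSucc - (Y k i).z 0)

/-- Every initial state lies in the ball of radius `r0` around `xbar`. -/
def InitialStates (x : ℕ → Fin (T + 1) → Vec nx) : Prop :=
  ∀ k, pnorm S.p (x k 0 - S.xbar) ≤ S.r0

/-- The trajectory of iteration `0` satisfies the constraints tightened with the worst-case
tube radii. -/
def InitialTrajectory (x₀ : Fin (T + 1) → Vec nx) (u₀ : Fin T → Vec nu) : Prop :=
  ∃ η₀ : Fin (T + 1) → ℝ, η₀ 0 = S.wbar ∧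
    (∀ t : Fin T, η₀ t.succ = S.mbar t * η₀ t.castSucc + 2 * S.wbar) ∧
    (x₀, u₀) ∈ S.tightSet η₀

/-- The optimizers of the iterative learning problem are strictly feasible. -/
def StrictlyFeasible (X : ℕ → ILCVar nx nu T) : Prop :=
  ∀ k, 1 ≤ k → ((X k).z, (X k).v) ∈ interior (S.tightSet (X k).η)

end ILPC

end

/-!
The tracking bound is a first-order optimality estimate for the iterative learning problem, and it
holds at every iteration `k ≥ 1`.

Strict feasibility means that no constraint is active at the optimizer: every row of the constraints
either holds with slack, or has zero coefficients, in which case it is not tightened by the tube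
radii either. Hence a small step in any direction of `(z, v, η)` stays admissible
(`ILPC.eventually_mem_tightSet`). The step used here moves the nominal trajectory `z` towards `r` by
a fraction `s`, keeping `v`, the selector and the state reference. With `e = r - z`, the disturbance
reference absorbs the change `s (e(t+1) - A(t) e(t))`, and it suffices to enlarge `ξ(t)` and `ρ(t)`
by `s ‖e(t)‖` and `s ‖e(t+1) - A(t) e(t)‖` (`ILPC.ILCFeasible.shift`). The quadratic part of the cost
is multiplied by `(1 - s)²`, while the penalties grow by at most `s c₁ G(e)`, where `G` is positively
homogeneous of degree one and depends on the data only. Optimality therefore gives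
`‖e‖_Q² ≤ c₁ G(e)` (`ILPC.ILCSolution.weightedSq_le`). As `Q` is positive definite, the left side is
at least `l ‖e‖²`, and the right side is at most `c₁ C ‖e‖`, so that `‖e‖ ≤ (C / l) c₁`. The class
`𝒦∞` functions are thus linear. The penalties being exact, the size of the estimation sets is
irrelevant, and no convergence of the estimates has to be established.
-/

/-! ### Norms and quadratic forms -/

lemma pnorm_nonneg (p : ℝ≥0∞) [Fact (1 ≤ p)] {n : ℕ} (x : Vec n) : 0 ≤ pnorm p x :=
  norm_nonneg _

lemma pnorm_add_le (p : ℝ≥0∞) [Fact (1 ≤ p)] {n : ℕ} (x y : Vec n) :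
    pnorm p (x + y) ≤ pnorm p x + pnorm p y := by
  simpa [pnorm] using norm_add_le (WithLp.toLp p x) (WithLp.toLp p y)

lemma pnorm_smul (p : ℝ≥0∞) [Fact (1 ≤ p)] {n : ℕ} {s : ℝ} (hs : 0 ≤ s) (x : Vec n) :
    pnorm p (s • x) = s * pnorm p x := by
  simp [pnorm, norm_smul, abs_of_nonneg hs]

/-- A linear map on a finite-dimensional space is bounded with respect to the `p`-norm. -/
lemma exists_pnorm_linearMap_le (p : ℝ≥0∞) [Fact (1 ≤ p)] {n : ℕ} {E : Type*}
    [NormedAddCommGroup E] [NormedSpace ℝ E] [FiniteDimensional ℝ E] (g : E →ₗ[ℝ] Vec n) :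
    ∃ C : ℝ, 0 ≤ C ∧ ∀ e, pnorm p (g e) ≤ C * ‖e‖ := by
  let g' := LinearMap.toContinuousLinearMap
    ((WithLp.linearEquiv p ℝ (Fin n → ℝ)).symm.toLinearMap ∘ₗ g)
  exact ⟨‖g'‖, norm_nonneg _, fun e => g'.le_opNorm e⟩

lemma weightedSq_smul {n l : ℕ} (Q : Matrix (Fin n) (Fin n) ℝ) (s : ℝ) (y : Fin l → Vec n) :
    weightedSq Q (s • y) = s ^ 2 * weightedSq Q y := by
  simp only [weightedSq, Finset.mul_sum]
  refine Finset.sum_congr rfl fun t _ => ?_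
  simp only [Pi.smul_apply, Matrix.mulVec_smul, smul_dotProduct, dotProduct_smul, smul_eq_mul]
  ring

lemma weightedSq_pos {n l : ℕ} {Q : Matrix (Fin n) (Fin n) ℝ} (hQ : Q.PosDef)
    {y : Fin l → Vec n} (hy : y ≠ 0) : 0 < weightedSq Q y := by
  obtain ⟨t, ht⟩ := Function.ne_iff.mp hy
  refine Finset.sum_pos' (fun i _ => ?_) ⟨t, Finset.mem_univ _, ?_⟩
  · simpa using hQ.posSemidef.dotProduct_mulVec_nonneg (y i)
  · simpa using hQ.dotProduct_mulVec_pos ht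

lemma exists_le_weightedSq {n l : ℕ} {Q : Matrix (Fin n) (Fin n) ℝ} (hQ : Q.PosDef) :
    ∃ c : ℝ, 0 < c ∧ ∀ y : Fin l → Vec n, c * ‖y‖ ^ 2 ≤ weightedSq Q y := by
  have hcont : Continuous fun y : Fin l → Vec n => weightedSq Q y := by
    unfold weightedSq
    simp only [dotProduct, Matrix.mulVec]
    fun_prop
  obtain ⟨c, hc, hcle⟩ : ∃ c : ℝ, 0 < c ∧
      ∀ y ∈ Metric.sphere (0 : Fin l → Vec n) 1, c ≤ weightedSq Q y := by
    rcases (Metric.sphere (0 : Fin l → Vec n) 1).eq_empty_or_nonempty with h | h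
    · exact ⟨1, one_pos, by simp [h]⟩
    · obtain ⟨y, hy, hmin⟩ := (isCompact_sphere _ _).exists_isMinOn h hcont.continuousOn
      refine ⟨_, weightedSq_pos hQ (y := y) ?_, fun z hz => hmin hz⟩
      rintro rfl
      simp at hy
  refine ⟨c, hc, fun y => ?_⟩
  rcases eq_or_ne y 0 with rfl | hy
  · simp [weightedSq]
  · have hn : 0 < ‖y‖ := norm_pos_iff.mpr hy
    have h := hcle (‖y‖⁻¹ • y) (by simp [norm_smul, hn.ne'])
    rw [weightedSq_smul, inv_pow, inv_mul_eq_div, le_div_iff₀ (by positivity)] at h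
    exact h

lemma isClassKInf_const_mul {c : ℝ} (hc : 0 < c) : IsClassKInf (fun s => c * s) where
  continuousOn := by fun_prop
  strictMonoOn := (strictMono_mul_left_of_pos hc).strictMonoOn _
  zero := mul_zero c
  tendsto := Filter.tendsto_id.const_mul_atTop hc

/-! ### Inactive constraints -/

/-- An affine inequality that is strict, or whose right-hand side does not change, survives a
small step. -/
lemma eventually_affine_le {a b c d : ℝ} (h : a ≤ b) (h' : a < b ∨ c = 0 ∧ d = 0) :
    ∀ᶠ s in nhdsWithin (0 : ℝ) (Set.Ioi 0), a + s * c ≤ b - s * d := by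
  rcases h' with hlt | ⟨rfl, rfl⟩
  · have hc : Continuous fun s : ℝ => (b - s * d) - (a + s * c) := by fun_prop
    have := (hc.tendsto 0).eventually_const_lt (u := 0) (by simpa using hlt)
    filter_upwards [nhdsWithin_le_nhds this] with s hs
    linarith
  · exact Filter.Eventually.of_forall fun _ => by simpa using h

/-- At an interior point of a set, one can move a little in every direction. -/
lemma exists_pos_add_smul_mem_of_mem_interior {E : Type*} [AddCommGroup E] [Module ℝ E]
    [TopologicalSpace E] [ContinuousAdd E] [ContinuousSMul ℝ E] {A : Set E} {q : E}
    (hq : q ∈ interior A) (d : E) : ∃ ε : ℝ, 0 < ε ∧ q + ε • d ∈ A := by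
  have hc : Continuous fun s : ℝ => q + s • d := by fun_prop
  have h0 : ∀ᶠ s in nhds (0 : ℝ), q + s • d ∈ A :=
    hc.continuousAt.eventually (by simpa using mem_interior_iff_mem_nhds.mp hq)
  have h0' : ∀ᶠ s in nhdsWithin (0 : ℝ) (Set.Ioi 0), q + s • d ∈ A := nhdsWithin_le_nhds h0
  obtain ⟨s, hs, hpos⟩ := (h0'.and self_mem_nhdsWithin).exists
  exact ⟨s, hpos, hs⟩

lemma rowSup_eq_zero (p : ℝ≥0∞) [Fact (1 ≤ p)] {n l : ℕ} {M : Matrix (Fin l) (Fin n) ℝ}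
    {j : Fin l} (h : M j = 0) : rowSup p M j = 0 := by
  have himg : (fun v : Vec n => (M.mulVec v) j) '' pball p 1 = {0} := by
    ext y
    simp only [Set.mem_image, Set.mem_singleton_iff, Matrix.mulVec, h, zero_dotProduct]
    exact ⟨fun ⟨_, _, h⟩ => h.symm, fun hy => ⟨0, by simp [pball, pnorm], hy.symm⟩⟩
  simp [rowSup, himg]

namespace ILPC

variable {nx nu nh nhT T : ℕ} {S : ILPC nx nu nh nhT T}

/-- A stage constraint is either inactive or trivial at an interior point. The witness moves along
the coefficient row of the constraint, which increases its left-hand side unless that row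
vanishes. -/
lemma stage_lt_or_row_eq_zero {η : Fin (T + 1) → ℝ} {z : Fin (T + 1) → Vec nx}
    {v : Fin T → Vec nu} (h : (z, v) ∈ interior (S.tightSet η)) (t : Fin T) (j : Fin nh) :
    (S.Hx.mulVec (z t.castSucc) + S.Hu.mulVec (v t)) j < (S.h - η t.castSucc • S.psi t) j ∨
      S.Hx j = 0 ∧ S.Hu j = 0 := by
  obtain ⟨ε, hε, hmem⟩ := exists_pos_add_smul_mem_of_mem_interior h
    ((fun _ => S.Hx j, fun _ => S.Hu j) : (Fin (T + 1) → Vec nx) × (Fin T → Vec nu))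
  have hj := hmem.1 t j
  by_cases hrow : S.Hx j = 0 ∧ S.Hu j = 0
  · exact Or.inr hrow
  left
  have hx0 : 0 ≤ S.Hx j ⬝ᵥ S.Hx j := Finset.sum_nonneg fun i _ => mul_self_nonneg _
  have hu0 : 0 ≤ S.Hu j ⬝ᵥ S.Hu j := Finset.sum_nonneg fun i _ => mul_self_nonneg _
  have hpos : 0 < S.Hx j ⬝ᵥ S.Hx j + S.Hu j ⬝ᵥ S.Hu j := by
    by_contra hle
    exact hrow ⟨dotProduct_self_eq_zero.mp (by linarith), dotProduct_self_eq_zero.mp (by linarith)⟩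
  refine lt_of_lt_of_le ?_ hj
  have := mul_pos hε hpos
  simp only [Prod.fst_add, Prod.snd_add, Prod.smul_fst, Prod.smul_snd, Pi.add_apply,
    Pi.smul_apply, Matrix.mulVec_add, Matrix.mulVec_smul, smul_eq_mul]
  simp only [Matrix.mulVec] at this ⊢
  linarith

lemma terminal_lt_or_row_eq_zero {η : Fin (T + 1) → ℝ} {z : Fin (T + 1) → Vec nx}
    {v : Fin T → Vec nu} (h : (z, v) ∈ interior (S.tightSet η)) (j : Fin nhT) :
    S.HxT.mulVec (z (Fin.last T)) j < (S.hT - η (Fin.last T) • S.psiT) j ∨ S.HxT j = 0 := by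
  obtain ⟨ε, hε, hmem⟩ := exists_pos_add_smul_mem_of_mem_interior h
    ((fun _ => S.HxT j, 0) : (Fin (T + 1) → Vec nx) × (Fin T → Vec nu))
  have hj := hmem.2 j
  by_cases hrow : S.HxT j = 0
  · exact Or.inr hrow
  left
  have hx0 : 0 ≤ S.HxT j ⬝ᵥ S.HxT j := Finset.sum_nonneg fun i _ => mul_self_nonneg _
  have hpos := hx0.lt_of_ne fun h0 => hrow (dotProduct_self_eq_zero.mp h0.symm)
  refine lt_of_lt_of_le ?_ hj
  have := mul_pos hε hpos
  simp only [Prod.fst_add, Prod.smul_fst, Pi.add_apply,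
    Pi.smul_apply, Matrix.mulVec_add, Matrix.mulVec_smul, smul_eq_mul]
  simp only [Matrix.mulVec] at this ⊢
  linarith

/-- Interiority is required for fixed tube radii `η` only, but it also leaves room for changing
them: constraints with zero coefficients are not tightened, and all others have slack. -/
lemma eventually_mem_tightSet [Fact (1 ≤ S.p)] {η : Fin (T + 1) → ℝ} {z : Fin (T + 1) → Vec nx}
    {v : Fin T → Vec nu} (h : (z, v) ∈ interior (S.tightSet η)) (e : Fin (T + 1) → Vec nx)
    (ζ : Fin (T + 1) → ℝ) :
    ∀ᶠ s in nhdsWithin (0 : ℝ) (Set.Ioi 0), (z + s • e, v) ∈ S.tightSet (η + s • ζ) := by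
  have hmem := interior_subset h
  have hstage : ∀ᶠ s in nhdsWithin (0 : ℝ) (Set.Ioi 0), ∀ (t : Fin T) (j : Fin nh),
      (S.Hx.mulVec (z t.castSucc) + S.Hu.mulVec (v t)) j + s * S.Hx.mulVec (e t.castSucc) j ≤
        (S.h - η t.castSucc • S.psi t) j - s * (ζ t.castSucc * S.psi t j) := by
    refine Filter.eventually_all.mpr fun t => Filter.eventually_all.mpr fun j =>
      eventually_affine_le (hmem.1 t j) ((stage_lt_or_row_eq_zero h t j).imp_right fun hr => ?_)
    have hrow : (S.Hx + S.Hu * S.K t) j = 0 := by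
      ext i
      simp [Matrix.mul_apply, hr.1, hr.2]
    simp [Matrix.mulVec, hr.1, psi, rowSup_eq_zero S.p hrow]
  have hterm : ∀ᶠ s in nhdsWithin (0 : ℝ) (Set.Ioi 0), ∀ j : Fin nhT,
      S.HxT.mulVec (z (Fin.last T)) j + s * S.HxT.mulVec (e (Fin.last T)) j ≤
        (S.hT - η (Fin.last T) • S.psiT) j - s * (ζ (Fin.last T) * S.psiT j) := by
    refine Filter.eventually_all.mpr fun j =>
      eventually_affine_le (hmem.2 j) ((terminal_lt_or_row_eq_zero h j).imp_right fun hr => ?_)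
    simp [Matrix.mulVec, hr, psiT, rowSup_eq_zero S.p hr]
  filter_upwards [hstage, hterm] with s hs hT
  refine ⟨fun t j => ?_, fun j => ?_⟩
  · have := hs t j
    simp only [Pi.add_apply, Pi.sub_apply, Pi.smul_apply, Matrix.mulVec_add, Matrix.mulVec_smul,
      smul_eq_mul] at this ⊢
    linarith
  · have := hT j
    simp only [Pi.add_apply, Pi.sub_apply, Pi.smul_apply, Matrix.mulVec_add, Matrix.mulVec_smul,
      smul_eq_mul] at this ⊢
    linarith

/-! ### Moving the nominal trajectory -/

/-- The change of the disturbance reference that compensates a change `e` of the nominal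
trajectory when the nominal input is kept. -/
noncomputable def residual (S : ILPC nx nu nh nhT T) (e : Fin (T + 1) → Vec nx)
    (t : Fin T) : Vec nx :=
  e t.succ - (S.A t).mulVec (e t.castSucc)

/-- The change of the tube radii caused by a change `e` of the nominal trajectory. -/
noncomputable def tubeChange (S : ILPC nx nu nh nhT T) (e : Fin (T + 1) → Vec nx) :
    Fin (T + 1) → ℝ :=
  Fin.induction 0 fun t ζ =>
    S.mbar t * ζ + S.m t * pnorm S.p (e t.castSucc) + pnorm S.p (S.residual e t)

/-- The rate at which the penalty terms (divided by `c₁`) grow along the direction `e`. -/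
noncomputable def penaltyRate (S : ILPC nx nu nh nhT T) (e : Fin (T + 1) → Vec nx) : ℝ :=
  ∑ t : Fin T, pnorm S.p (e t.castSucc) + ∑ t, 1 / S.m t * pnorm S.p (S.residual e t)

/-- The decision variables after moving the nominal trajectory by `s • e`, with the nominal input,
the selector `α` and the state reference unchanged. -/
noncomputable def shift (S : ILPC nx nu nh nhT T) (X : ILCVar nx nu T)
    (e : Fin (T + 1) → Vec nx) (s : ℝ) :
    ILCVar nx nu T where
  z := X.z + s • e
  v := X.v
  ξ := fun t => X.ξ t + s * pnorm S.p (e t.castSucc)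
  ρ := fun t => X.ρ t + s * pnorm S.p (S.residual e t)
  η := X.η + s • S.tubeChange e
  dref := X.dref + s • S.residual e
  xref := X.xref
  α := X.α

lemma ILCFeasible.shift [Fact (1 ≤ S.p)] {D Dref : Fin T → Set (Vec nx)}
    {xprev xrefprev : Fin T → Vec nx} {X : ILCVar nx nu T}
    (hX : S.ILCFeasible D Dref xprev xrefprev X) {e : Fin (T + 1) → Vec nx} (he : e 0 = 0)
    {s : ℝ} (hs : 0 ≤ s) (hmem : (X.z + s • e, X.v) ∈ S.tightSet (X.η + s • S.tubeChange e)) :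
    S.ILCFeasible D Dref xprev xrefprev (S.shift X e s) where
  z_init := by simp [ILPC.shift, he, hX.z_init]
  η_init := by simp [ILPC.shift, tubeChange, hX.η_init]
  z_dyn t := by
    simp only [ILPC.shift, Pi.add_apply, Pi.smul_apply, hX.z_dyn t, residual, Matrix.mulVec_add,
      Matrix.mulVec_smul, smul_sub]
    abel
  η_dyn t := by
    have hsucc : S.tubeChange e t.succ = S.mbar t * S.tubeChange e t.castSucc +
        S.m t * pnorm S.p (e t.castSucc) + pnorm S.p (S.residual e t) := by
      simp [tubeChange]
    simp only [ILPC.shift, Pi.add_apply, Pi.smul_apply, hX.η_dyn t, hsucc, smul_eq_mul]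
    ring
  α_mem := hX.α_mem
  xref_eq := hX.xref_eq
  ξ_bound t := by
    have h := pnorm_add_le S.p (X.z t.castSucc - X.xref t) (s • e t.castSucc)
    rw [pnorm_smul S.p hs] at h
    simp only [ILPC.shift, Pi.add_apply, Pi.smul_apply]
    rw [add_sub_right_comm]
    linarith [hX.ξ_bound t]
  ρ_nonneg t := add_nonneg (hX.ρ_nonneg t) (mul_nonneg hs (pnorm_nonneg _ _))
  ρ_bound t d₁ h₁ d₂ h₂ := by
    have h := pnorm_add_le S.p (X.dref t - X.α t • d₁ - (1 - X.α t) • d₂) (s • S.residual e t)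
    rw [pnorm_smul S.p hs] at h
    simp only [ILPC.shift, Pi.add_apply, Pi.smul_apply]
    rw [add_sub_right_comm, add_sub_right_comm]
    linarith [hX.ρ_bound t d₁ h₁ d₂ h₂]
  mem := hmem

lemma ilcCost_shift_le [Fact (1 ≤ S.p)] {c₁ : ℝ} (hc : 0 ≤ c₁) (X : ILCVar nx nu T) {s : ℝ}
    (hs : 0 ≤ s) :
    S.ilcCost c₁ (S.shift X (S.r - X.z) s) ≤
      S.ilcCost c₁ X - weightedSq S.Q (X.z - S.r) + (1 - s) ^ 2 * weightedSq S.Q (X.z - S.r) +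
        s * (c₁ * S.penaltyRate (S.r - X.z)) := by
  have hq : weightedSq S.Q (X.z + s • (S.r - X.z) - S.r) =
      (1 - s) ^ 2 * weightedSq S.Q (X.z - S.r) := by
    rw [← weightedSq_smul]
    congr 1
    module
  have hξ : ∑ t, |X.ξ t + s * pnorm S.p ((S.r - X.z) t.castSucc)| ≤
      ∑ t, |X.ξ t| + s * ∑ t : Fin T, pnorm S.p ((S.r - X.z) t.castSucc) := by
    rw [Finset.mul_sum, ← Finset.sum_add_distrib]
    refine Finset.sum_le_sum fun t _ => (abs_add_le _ _).trans_eq ?_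
    rw [abs_of_nonneg (mul_nonneg hs (pnorm_nonneg _ _))]
  have hρ : ∑ t, c₁ / S.m t * (X.ρ t + s * pnorm S.p (S.residual (S.r - X.z) t)) =
      ∑ t, c₁ / S.m t * X.ρ t +
        s * (c₁ * ∑ t, 1 / S.m t * pnorm S.p (S.residual (S.r - X.z) t)) := by
    rw [Finset.mul_sum, Finset.mul_sum, ← Finset.sum_add_distrib]
    exact Finset.sum_congr rfl fun t _ => by ring
  simp only [ilcCost, shift, penaltyRate]
  rw [hq, hρ]
  nlinarith [mul_le_mul_of_nonneg_left hξ hc]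

/-- First-order optimality at a strictly feasible optimizer, in the direction of the reference. -/
lemma ILCSolution.weightedSq_le [Fact (1 ≤ S.p)] {c₁ : ℝ} (hc : 0 ≤ c₁)
    {D Dref : Fin T → Set (Vec nx)} {xprev xrefprev : Fin T → Vec nx} {X : ILCVar nx nu T}
    (hX : S.ILCSolution c₁ D Dref xprev xrefprev X)
    (hint : (X.z, X.v) ∈ interior (S.tightSet X.η)) (hr : S.r 0 = S.xbar)
    (hQ : 0 ≤ weightedSq S.Q (X.z - S.r)) :
    weightedSq S.Q (X.z - S.r) ≤ c₁ * S.penaltyRate (S.r - X.z) := by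
  have h1 : ∀ᶠ s in nhdsWithin (0 : ℝ) (Set.Ioi 0), s < 1 :=
    nhdsWithin_le_nhds (eventually_lt_nhds one_pos)
  obtain ⟨s, ⟨hmem, hs1⟩, hs0 : 0 < s⟩ :=
    (((eventually_mem_tightSet hint (S.r - X.z) (S.tubeChange (S.r - X.z))).and h1).and
      self_mem_nhdsWithin).exists
  have he : (S.r - X.z) 0 = 0 := by simp [hr, hX.1.z_init]
  have hopt := (hX.2 _ (hX.1.shift he hs0.le hmem)).trans (ilcCost_shift_le hc X hs0.le)
  -- Cancelling the cost of `X` and dividing by `s` leaves the factor `2 - s ≥ 1` on the left.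
  have hdiv : (2 - s) * weightedSq S.Q (X.z - S.r) ≤ c₁ * S.penaltyRate (S.r - X.z) :=
    le_of_mul_le_mul_left (by linarith) hs0
  nlinarith

lemma exists_penaltyRate_le (S : ILPC nx nu nh nhT T) [Fact (1 ≤ S.p)] (hm : ∀ t, 0 < S.m t) :
    ∃ C : ℝ, 0 ≤ C ∧ ∀ e, S.penaltyRate e ≤ C * ‖e‖ := by
  choose a ha hale using fun t : Fin T => exists_pnorm_linearMap_le S.p
    (LinearMap.proj t.castSucc : (Fin (T + 1) → Vec nx) →ₗ[ℝ] Vec nx)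
  choose b hb hble using fun t : Fin T => exists_pnorm_linearMap_le S.p
    ((LinearMap.proj t.succ : (Fin (T + 1) → Vec nx) →ₗ[ℝ] Vec nx) -
      (S.A t).mulVecLin ∘ₗ LinearMap.proj t.castSucc)
  refine ⟨∑ t, a t + ∑ t, 1 / S.m t * b t, add_nonneg (Finset.sum_nonneg fun t _ => ha t)
    (Finset.sum_nonneg fun t _ => mul_nonneg (one_div_pos.mpr (hm t)).le (hb t)), fun e => ?_⟩
  rw [add_mul, Finset.sum_mul, Finset.sum_mul]
  refine add_le_add (Finset.sum_le_sum fun t _ => hale t e) (Finset.sum_le_sum fun t _ => ?_)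
  rw [mul_assoc]
  exact mul_le_mul_of_nonneg_left (hble t e) (one_div_pos.mpr (hm t)).le

/-- The nominal trajectory is within a constant multiple of `c₁` of the reference, uniformly over
all strictly feasible optimizers of all instances of the iterative learning problem. -/
lemma exists_pnorm_sub_ref_le (S : ILPC nx nu nh nhT T) [Fact (1 ≤ S.p)] (hm : ∀ t, 0 < S.m t)
    (hQ : S.Q.PosDef) (hr : S.r 0 = S.xbar) :
    ∃ M : Fin (T + 1) → ℝ, (∀ t, 0 < M t) ∧ ∀ c₁ : ℝ, 0 < c₁ →
      ∀ (D Dref : Fin T → Set (Vec nx)) (xprev xrefprev : Fin T → Vec nx) (X : ILCVar nx nu T),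
        S.ILCSolution c₁ D Dref xprev xrefprev X → (X.z, X.v) ∈ interior (S.tightSet X.η) →
        ∀ t, pnorm S.p (X.z t - S.r t) ≤ M t * c₁ := by
  obtain ⟨C, hC, hrate⟩ := S.exists_penaltyRate_le hm
  obtain ⟨l, hl, hle⟩ := exists_le_weightedSq (l := T + 1) hQ
  choose a ha hale using fun t : Fin (T + 1) => exists_pnorm_linearMap_le S.p
    (LinearMap.proj t : (Fin (T + 1) → Vec nx) →ₗ[ℝ] Vec nx)
  -- Adding `1` makes the constants positive, as required for strict monotonicity.
  refine ⟨fun t => a t * (C / l) + 1, fun t => by have := ha t; positivity, ?_⟩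
  intro c₁ hc D Dref xprev xrefprev X hX hint t
  have hq := hle (X.z - S.r)
  have hopt := hX.weightedSq_le hc.le hint hr (le_trans (by positivity) hq)
  have hG := mul_le_mul_of_nonneg_left (hrate (S.r - X.z)) hc.le
  rw [norm_sub_rev] at hG
  have hnorm : ‖X.z - S.r‖ ≤ C / l * c₁ := by
    rcases (norm_nonneg (X.z - S.r)).eq_or_lt with h0 | hpos
    · rw [← h0]
      positivity
    · have h : l * ‖X.z - S.r‖ ≤ C * c₁ := le_of_mul_le_mul_right (by linarith) hpos
      rw [div_mul_eq_mul_div, le_div_iff₀ hl]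
      linarith
  calc pnorm S.p (X.z t - S.r t) ≤ a t * ‖X.z - S.r‖ := hale t (X.z - S.r)
    _ ≤ a t * (C / l * c₁) := mul_le_mul_of_nonneg_left hnorm (ha t)
    _ ≤ (a t * (C / l) + 1) * c₁ := by linarith

end ILPC

/-! ### The tracking bound -/

theorem theorem1 {nx nu nh nhT T : ℕ} (S : ILPC nx nu nh nhT T)
    (hp : S.p = 2 ∨ S.p = ∞) (hr0 : 0 ≤ S.r0) (hwbar : 0 ≤ S.wbar)
    (hm : ∀ t, 0 < S.m t) (hQ : S.Q.PosDef) (hP : S.P.PosSemidef)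
    (hLip : S.LipschitzDisturbance) (href : S.RealizableReference)
    {Ω : Type*} [MeasurableSpace Ω] (μ : MeasureTheory.Measure Ω)
    [MeasureTheory.IsProbabilityMeasure μ]
    (w : ℕ → Fin T → Ω → Vec nx) (hwmeas : ∀ k t, Measurable (w k t))
    (hnoise : S.NoiseAssumption μ w) :
    ∃ hfun : Fin (T + 1) → ℝ → ℝ, (∀ t, IsClassKInf (hfun t)) ∧
      ∀ c₁ : ℝ, 0 < c₁ →
      ∀ (x : Ω → ℕ → Fin (T + 1) → Vec nx) (u : Ω → ℕ → Fin T → Vec nu)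
        (X : Ω → ℕ → ILCVar nx nu T)
        (Y : Ω → ℕ → (i : Fin T) → MPCVar nx nu (T - i)),
        (∀ᵐ ω ∂μ, S.IsRun c₁ (fun k t => w k t ω) (x ω) (u ω) (X ω) (Y ω)) →
        (∀ᵐ ω ∂μ, S.InitialStates (x ω)) →
        (∀ᵐ ω ∂μ, S.InitialTrajectory (x ω 0) (u ω 0)) →
        (∀ᵐ ω ∂μ, S.StrictlyFeasible (X ω)) →
        ∀ᵐ ω ∂μ, ∀ t : Fin (T + 1),
          Filter.limsup (fun k : ℕ => ((pnorm S.p ((X ω k).z t - S.r t) : ℝ) : EReal))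
            Filter.atTop ≤ ((hfun t c₁ : ℝ) : EReal) := by
  have : Fact (1 ≤ S.p) := ⟨by rcases hp with h | h <;> simp [h]⟩
  obtain ⟨vstar, ηstar, hstar, -⟩ := href
  obtain ⟨M, hM, hbound⟩ := S.exists_pnorm_sub_ref_le hm hQ hstar.z_init
  refine ⟨fun t c₁ => M t * c₁, fun t => isClassKInf_const_mul (hM t), ?_⟩
  intro c₁ hc x u X Y hrun _ _ hstrict
  filter_upwards [hrun, hstrict] with ω hω hint t
  refine Filter.limsup_le_of_le (by isBoundedDefault) ?_
  filter_upwards [Filter.eventually_ge_atTop 1] with k hk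
  obtain ⟨k, rfl⟩ := Nat.exists_eq_add_of_le' hk
  exact EReal.coe_le_coe_iff.mpr (hbound c₁ hc _ _ _ _ _ (hω.ilc k) (hint _ hk) t)
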